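/- Let $C$ be a commutative unital ring in which $2$ is invertible. Let $S$ be the free supercommutative algebra over $C$: the unital associative $C$-superalgebra generated by even generators $y_1,y_2,\dots$ and odd generators $z_1,z_2,\dots$, subject only to the relations $uv=(-1)^{|u||v|}vu$ for all homogeneous elements $u,v$ (where $|u|\in\{0,1\}$ denotes the parity of $u$). Let $C\langle X\rangle$ be the free associative $C$-algebra on a countably infinite alphabet $X$, and let $T(S)\subseteq C\langle X\rangle$ be the ideal of all polynomial identities of $S$, that is, of all $f(x_1,\dots,x_n)\in C\langle X\rangle$ with $f(a_1,\dots,a_n)=0$ for all $a_1,\dots,a_n\in S$. Then $T(S)$ is generated as a T-ideal by the Grassmann identity: $T(S)$ is the smallest two-sided ideal of $C\langle X\rangle$ that contains $[x_1,[x_2,x_3]]$ (where $x_1,x_2,x_3\in X$ are distinct) and is mapped into itself by every $C$-algebra endomorphism of $C\langle X\rangle$. -/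

import Mathlib

namespace GrassmannPI

universe u v

/-! ### Identities and T-ideals

The free associative algebra over the countable alphabet `x₀, x₁, x₂, …` is `FreeAlgebra C ℕ`. -/

section Identities

variable (C : Type u) [CommRing C]

/-- A polynomial `f` is an identity of the algebra `A` if every substitution of elements of `A`
for the variables sends `f` to `0`. -/
def IsIdentity (A : Type v) [Ring A] [Algebra C A] (f : FreeAlgebra C ℕ) : Prop :=
  ∀ a : ℕ → A, FreeAlgebra.lift C a f = 0

/-- The ideal `T(A)` of all polynomial identities of `A`. -/
def identities (A : Type v) [Ring A] [Algebra C A] : TwoSidedIdeal (FreeAlgebra C ℕ) :=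
  TwoSidedIdeal.mk' {f | IsIdentity C A f}
    (fun a => map_zero _)
    (fun hx hy a => by rw [map_add, hx a, hy a, add_zero])
    (fun hx a => by rw [map_neg, hx a, neg_zero])
    (fun hy a => by rw [map_mul, hy a, mul_zero])
    (fun hx a => by rw [map_mul, hx a, zero_mul])

theorem mem_identities (A : Type v) [Ring A] [Algebra C A] (f : FreeAlgebra C ℕ) :
    f ∈ identities C A ↔ IsIdentity C A f :=
  TwoSidedIdeal.mem_mk' _ _ _ _ _ _ _

variable {C}

/-- A T-ideal is a two-sided ideal of the free algebra that is mapped into itself by every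
endomorphism of the free algebra. -/
def IsTIdeal (I : TwoSidedIdeal (FreeAlgebra C ℕ)) : Prop :=
  ∀ τ : FreeAlgebra C ℕ →ₐ[C] FreeAlgebra C ℕ, ∀ f ∈ I, τ f ∈ I

/-- The T-ideal generated by a set of polynomials: the smallest T-ideal containing it. -/
def tIdealSpan (s : Set (FreeAlgebra C ℕ)) : TwoSidedIdeal (FreeAlgebra C ℕ) :=
  sInf {I | IsTIdeal I ∧ s ⊆ (I : Set (FreeAlgebra C ℕ))}

variable (C)

/-- The Grassmann identity `[x, [y, z]]`, written in the first three variables. -/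
def grassmannPoly : FreeAlgebra C ℕ :=
  ⁅FreeAlgebra.ι C 0, ⁅FreeAlgebra.ι C 1, FreeAlgebra.ι C 2⁆⁆

end Identities

/-! ### The free supercommutative algebra -/

section FreeSupercommutative

variable (C : Type u) [CommRing C]

/-- The word `g₁ g₂ ⋯ gₙ` in the free algebra on the generators `yₙ = Sum.inl n` (even) and
`zₙ = Sum.inr n` (odd). -/
def word (w : List (ℕ ⊕ ℕ)) : FreeAlgebra C (ℕ ⊕ ℕ) :=
  (w.map (FreeAlgebra.ι C)).prod

/-- The homogeneous part of parity `i` of the free superalgebra on the even generators `yₙ` and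
the odd generators `zₙ`: the span of the words in which the number of odd generators, counted
with multiplicity, is congruent to `i` modulo `2`. -/
def parityPart (i : ZMod 2) : Submodule C (FreeAlgebra C (ℕ ⊕ ℕ)) :=
  Submodule.span C {f | ∃ w : List (ℕ ⊕ ℕ), (w.countP Sum.isRight : ZMod 2) = i ∧ f = word C w}

/-- The relations `x y = (-1)^(|x| |y|) y x`, one for each pair of homogeneous elements `x, y`;
that is, all supercommutators are set equal to zero. -/
inductive SupercommRel : FreeAlgebra C (ℕ ⊕ ℕ) → FreeAlgebra C (ℕ ⊕ ℕ) → Prop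
  | swap (i j : ZMod 2) (x y : FreeAlgebra C (ℕ ⊕ ℕ))
      (hx : x ∈ parityPart C i) (hy : y ∈ parityPart C j) :
      SupercommRel (x * y) ((-1) ^ (i.val * j.val) * (y * x))

/-- The free supercommutative (unital, associative) `C`-algebra `S` on countably many even
generators `yₙ` and countably many odd generators `zₙ`. -/
abbrev FreeSupercomm : Type u := RingQuot (SupercommRel C)

end FreeSupercommutative

end GrassmannPI

/-!
The free supercommutative algebra `S` satisfies the Grassmann identity because the commutator of
two elements is the commutator of their odd parts, hence even, hence central
(`FreeSupercomm.lie_lie`).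

Conversely, let `R` be the quotient of the free algebra by the T-ideal of `[x, [y, z]]`. In `R` all
commutators are central, and expanding `[a, b c]` gives `[a, b] [c, d] = -[a, c] [b, d]`
(`lie_mul_lie_swap`). So a product of commutators of variables is alternating in all of its entries,
while interchanging two letters of a word produces a commutator and a shorter word. It follows that
`R` is spanned by the normal monomials `x^m [x_{i₁}, x_{i₂}] ⋯ [x_{i_{2k-1}}, x_{i_{2k}}]` with `m` a
multiset and `i₁ < ⋯ < i_{2k}` (`lift_mem_span_normalMonomial`).

These monomials stay linearly independent in `S`. Given a nontrivial linear combination that is an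
identity of `S`, let `s` be a smallest index set of a commutator part that occurs in it, and
substitute `xᵢ ↦ yᵢ + zᵢ` for `i ∈ s` and `xᵢ ↦ yᵢ` otherwise. Since `[xᵢ, xⱼ] ↦ 2 zᵢ zⱼ`, a monomial
whose index set is not contained in `s` becomes `0`, and by minimality only the monomials with index
set `s` remain. For these, the odd parts in the factor `x^m` are killed by the product of the `zᵢ`,
`i ∈ s`, so that the value is `2^k y^m ∏ zᵢ` (`normalMonomial_eq_smul`). The commutative monomials
`y^m` are independent, `2` is invertible, and no nonzero polynomial in the `yᵢ` annihilates `∏ zᵢ`;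
the last fact is read off in an exterior algebra over the polynomial ring, to which `S` maps
(`eq_zero_of_smul_prod_oddGen`).
-/

namespace GrassmannPI

/-! ### Rings with central commutators -/

section CentralCommutators

variable {A : Type*} [Ring A]

/-- The product `[x a₁, x a₂] [x a₃, x a₄] ⋯` of the commutators of consecutive pairs in a list of
indices. On a list of odd length the value is `0`: with this convention the product changes sign
under every transposition of neighbours, whatever the length of the list. -/
def commProd (x : ℕ → A) : List ℕ → A
  | [] => 1
  | [_] => 0
  | a :: b :: l => ⁅x a, x b⁆ * commProd x l

theorem commProd_eq_zero_of_odd (x : ℕ → A) :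
    ∀ l : List ℕ, Odd l.length → commProd x l = 0
  | [], h => by simp at h
  | [_], _ => rfl
  | a :: b :: l, h => by
    have : Odd l.length := by simpa [Nat.odd_add_one, parity_simps] using h
    rw [commProd, commProd_eq_zero_of_odd x l this, mul_zero]

theorem mul_lie_comm (hA : ∀ a b c : A, ⁅a, ⁅b, c⁆⁆ = 0) (a b c : A) :
    a * ⁅b, c⁆ = ⁅b, c⁆ * a := by
  have := hA a b c
  rwa [Ring.lie_def, sub_eq_zero] at this

/-- Expanding the central element `[a, b c] = [a, b] c + b [a, c]` and commuting it with `d` shows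
that a product of two commutators is skew in the two middle entries. -/
theorem lie_mul_lie_swap (hA : ∀ a b c : A, ⁅a, ⁅b, c⁆⁆ = 0) (a b c d : A) :
    ⁅a, b⁆ * ⁅c, d⁆ = -(⁅a, c⁆ * ⁅b, d⁆) := by
  have e : ⁅a, b * c⁆ = ⁅a, b⁆ * c + b * ⁅a, c⁆ := by
    simp only [Ring.lie_def]; noncomm_ring
  have h := mul_lie_comm hA d a (b * c)
  rw [e, mul_add, add_mul, ← mul_assoc, mul_lie_comm hA d a b, ← mul_assoc, mul_assoc b,
    ← mul_lie_comm hA d a c, mul_assoc, ← sub_eq_zero] at h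
  have h' : ⁅a, b⁆ * ⁅c, d⁆ + ⁅b, d⁆ * ⁅a, c⁆ = 0 := by
    rw [← neg_eq_zero, ← h]
    simp only [Ring.lie_def c d, Ring.lie_def b d]
    noncomm_ring
  rw [mul_lie_comm hA ⁅b, d⁆ a c] at h'
  exact eq_neg_of_add_eq_zero_left h'

theorem commProd_swap (hA : ∀ a b c : A, ⁅a, ⁅b, c⁆⁆ = 0) (x : ℕ → A) (a b : ℕ) (q : List ℕ) :
    ∀ p : List ℕ, commProd x (p ++ a :: b :: q) = -commProd x (p ++ b :: a :: q)
  | [] => by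
    simp only [List.nil_append, commProd, ← neg_mul, Ring.lie_def, neg_sub]
  | [c] => by
    cases q with
    | nil => simp [commProd]
    | cons d q =>
      simp only [List.cons_append, List.nil_append, commProd]
      rw [← mul_assoc, lie_mul_lie_swap hA, neg_mul, mul_assoc]
  | c :: d :: p => by
    simp only [List.cons_append, commProd]
    rw [commProd_swap hA x a b q p, mul_neg]

theorem commProd_perm (hA : ∀ a b c : A, ⁅a, ⁅b, c⁆⁆ = 0) (x : ℕ → A) {l l' : List ℕ}
    (h : l.Perm l') :
    commProd x l = commProd x l' ∨ commProd x l = -commProd x l' := by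
  suffices H : ∀ p : List ℕ, commProd x (p ++ l) = commProd x (p ++ l') ∨
      commProd x (p ++ l) = -commProd x (p ++ l') from H []
  induction h with
  | nil => exact fun p => Or.inl rfl
  | cons a _ ih =>
    intro p
    simpa using ih (p ++ [a])
  | swap a b q => exact fun p => Or.inr (commProd_swap hA x b a q p)
  | trans _ _ ih₁ ih₂ =>
    intro p
    rcases ih₁ p with h₁ | h₁ <;> rcases ih₂ p with h₂ | h₂ <;> simp [h₁, h₂]

theorem commProd_eq_zero_of_not_nodup (hA : ∀ a b c : A, ⁅a, ⁅b, c⁆⁆ = 0)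
    (x : ℕ → A) {l : List ℕ} (hl : ¬ l.Nodup) : commProd x l = 0 := by
  obtain ⟨a, q, hq⟩ : ∃ a q, l.Perm (a :: a :: q) := by
    obtain ⟨a, ha⟩ : ∃ a, List.Duplicate a l := by
      simpa [List.nodup_iff_forall_not_duplicate] using hl
    have h1 := List.perm_cons_erase ha.mem
    have h3 : a ∈ l.erase a := by
      rw [← List.count_pos_iff, List.count_erase_self]
      have := List.duplicate_iff_two_le_count.1 ha
      omega
    exact ⟨a, _, h1.trans ((List.perm_cons_erase h3).cons a)⟩
  have h0 : commProd x (a :: a :: q) = 0 := by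
    simp [commProd, Ring.lie_def]
  rcases commProd_perm hA x hq with h | h <;> simp [h, h0]

/-- The normal monomial `x^m [x_{i₁}, x_{i₂}] ⋯ [x_{i_{2k-1}}, x_{i_{2k}}]`, in which `x^m` is the
product of the entries of the multiset `m` in increasing order, and `i₁ < i₂ < ⋯` are the elements
of `s`. -/
def normalMonomial (x : ℕ → A) (m : Multiset ℕ) (s : Finset ℕ) : A :=
  (m.sort.map x).prod * commProd x s.sort

theorem map_commProd {B F : Type*} [Ring B] [FunLike F A B] [RingHomClass F A B] (φ : F)
    (x : ℕ → A) :
    ∀ l : List ℕ, φ (commProd x l) = commProd (φ ∘ x) l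
  | [] => map_one φ
  | [_] => map_zero φ
  | a :: b :: l => by simp [commProd, Ring.lie_def, map_commProd φ x l]

theorem map_normalMonomial {B F : Type*} [Ring B] [FunLike F A B] [RingHomClass F A B] (φ : F)
    (x : ℕ → A) (m : Multiset ℕ) (s : Finset ℕ) :
    φ (normalMonomial x m s) = normalMonomial (φ ∘ x) m s := by
  simp [normalMonomial, map_commProd, map_list_prod]

variable {C : Type*} [CommRing C] [Algebra C A]

/-- Interchanging two neighbouring letters of a word costs a commutator times a word that is
shorter by two letters. -/
theorem prod_swap_mul_commProd (hA : ∀ a b c : A, ⁅a, ⁅b, c⁆⁆ = 0) (x : ℕ → A) (a b : ℕ)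
    (p q l : List ℕ) :
    ((p ++ a :: b :: q).map x).prod * commProd x l -
      ((p ++ b :: a :: q).map x).prod * commProd x l =
      ((p ++ q).map x).prod * commProd x (a :: b :: l) := by
  simp only [List.map_append, List.map_cons, List.prod_append, List.prod_cons, commProd]
  rw [← mul_assoc _ ⁅x a, x b⁆, mul_assoc _ _ ⁅x a, x b⁆, mul_lie_comm hA, Ring.lie_def]
  noncomm_ring

/-- Modulo a submodule that contains all products of shorter words with commutators, the letters
of a word may be permuted. -/
theorem prod_perm_mul_commProd_sub_mem (hA : ∀ a b c : A, ⁅a, ⁅b, c⁆⁆ = 0) (x : ℕ → A)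
    (N : Submodule C A) (n : ℕ)
    (hN : ∀ v l : List ℕ, v.length < n → (v.map x).prod * commProd x l ∈ N) {w w' : List ℕ}
    (h : w.Perm w') :
    ∀ p l : List ℕ, (p ++ w).length ≤ n → ((p ++ w).map x).prod * commProd x l -
      ((p ++ w').map x).prod * commProd x l ∈ N := by
  induction h with
  | nil => intro p l _; simp
  | cons a _ ih =>
    intro p l hn
    simpa using ih (p ++ [a]) l (by simpa using hn)
  | swap a b q =>
    intro p l hn
    rw [prod_swap_mul_commProd hA]
    refine hN _ _ ?_
    simp only [List.length_append, List.length_cons] at hn ⊢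
    omega
  | trans h₁ _ ih₁ ih₂ =>
    intro p l hn
    have := N.add_mem (ih₁ p l hn) (ih₂ p l (by simpa [h₁.length_eq] using hn))
    simpa using this

theorem prod_mul_commProd_mem_span (hA : ∀ a b c : A, ⁅a, ⁅b, c⁆⁆ = 0)
    (x : ℕ → A) (w l : List ℕ) :
    (w.map x).prod * commProd x l ∈ Submodule.span C
      (Set.range fun t : Multiset ℕ × {s : Finset ℕ // Even s.card} =>
        normalMonomial x t.1 t.2) := by
  induction hn : w.length using Nat.strong_induction_on generalizing w l with
  | _ n ih =>
    set N := Submodule.span C (Set.range fun t : Multiset ℕ × {s : Finset ℕ // Even s.card} =>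
      normalMonomial x t.1 t.2)
    have hperm : w.Perm (w : Multiset ℕ).sort := by
      rw [← Multiset.coe_eq_coe, Multiset.sort_eq]
    have hsub := prod_perm_mul_commProd_sub_mem hA x N n (fun v l hv => ih _ hv v l rfl) hperm
      [] l (by simp [hn])
    suffices h : ((w : Multiset ℕ).sort.map x).prod * commProd x l ∈ N by
      simpa using N.add_mem hsub h
    rcases Nat.even_or_odd l.length with he | ho
    · by_cases hl : l.Nodup
      · have hcard : l.toFinset.card = l.length := List.toFinset_card_of_nodup hl
        have hmem : normalMonomial x (w : Multiset ℕ) l.toFinset ∈ N :=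
          Submodule.subset_span ⟨(↑w, ⟨l.toFinset, by rwa [hcard]⟩), rfl⟩
        have hp : l.Perm l.toFinset.sort :=
          ((Finset.sort_perm_toList _ _).trans (List.toFinset_toList hl)).symm
        rcases commProd_perm hA x hp with h | h
        · rw [h]; exact hmem
        · rw [h, mul_neg]; exact N.neg_mem hmem
      · rw [commProd_eq_zero_of_not_nodup hA x hl, mul_zero]; exact N.zero_mem
    · rw [commProd_eq_zero_of_odd x l ho, mul_zero]; exact N.zero_mem

end CentralCommutators

/-! ### Words in a free algebra -/

theorem FreeAlgebra.span_words (C : Type*) [CommRing C] (X : Type*) :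
    Submodule.span C (Set.range fun w : List X => (w.map (FreeAlgebra.ι C)).prod) = ⊤ := by
  rw [eq_top_iff]
  have h := Algebra.adjoin_eq_span C (Set.range (FreeAlgebra.ι C : X → FreeAlgebra C X))
  rw [FreeAlgebra.adjoin_range_ι, Algebra.top_toSubmodule] at h
  rw [h, Submodule.span_le]
  intro f hf
  obtain ⟨l, hl, rfl⟩ := Submonoid.exists_list_of_mem_closure hf
  refine Submodule.subset_span ?_
  obtain ⟨w, rfl⟩ : l ∈ Set.range (List.map (FreeAlgebra.ι C)) := by
    rw [Set.range_list_map]; exact hl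
  exact ⟨w, rfl⟩

/-- In an algebra with central commutators, every value of a polynomial is a linear combination of
normal monomials. -/
theorem lift_mem_span_normalMonomial {A : Type*} [Ring A] {C : Type*} [CommRing C] [Algebra C A]
    (hA : ∀ a b c : A, ⁅a, ⁅b, c⁆⁆ = 0) (x : ℕ → A)
    (f : FreeAlgebra C ℕ) :
    FreeAlgebra.lift C x f ∈ Submodule.span C
      (Set.range fun t : Multiset ℕ × {s : Finset ℕ // Even s.card} =>
        normalMonomial x t.1 t.2) := by
  have hf : f ∈ Submodule.span C
      (Set.range fun w : List ℕ => (w.map (FreeAlgebra.ι C)).prod) := by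
    rw [FreeAlgebra.span_words]; trivial
  induction hf using Submodule.span_induction with
  | mem f hf =>
    obtain ⟨w, rfl⟩ := hf
    have := prod_mul_commProd_mem_span (C := C) hA x w []
    simpa [commProd, map_list_prod, Function.comp_def] using this
  | zero => simp
  | add f g _ _ hf hg => rw [map_add]; exact add_mem hf hg
  | smul c f _ hf => rw [map_smul]; exact Submodule.smul_mem _ c hf

/-! ### The Grassmann identity in the free supercommutative algebra -/

section Supercommutative

variable (C : Type*) [CommRing C]

theorem word_append (v w : List (ℕ ⊕ ℕ)) : word C (v ++ w) = word C v * word C w := by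
  simp [word]

theorem mul_mem_parityPart {i j : ZMod 2} {f g : FreeAlgebra C (ℕ ⊕ ℕ)}
    (hf : f ∈ parityPart C i) (hg : g ∈ parityPart C j) : f * g ∈ parityPart C (i + j) := by
  have h := Submodule.mul_mem_mul hf hg
  rw [parityPart, parityPart, Submodule.span_mul_span] at h
  refine Submodule.span_mono ?_ h
  rintro _ ⟨_, ⟨v, hv, rfl⟩, _, ⟨w, hw, rfl⟩, rfl⟩
  exact ⟨v ++ w, by simp [hv, hw], (word_append C v w).symm⟩

theorem exists_parity_add (f : FreeAlgebra C (ℕ ⊕ ℕ)) :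
    ∃ g ∈ parityPart C 0, ∃ h ∈ parityPart C 1, f = g + h := by
  have hf : f ∈ parityPart C 0 ⊔ parityPart C 1 := by
    have ht : f ∈ (⊤ : Submodule C (FreeAlgebra C (ℕ ⊕ ℕ))) := trivial
    rw [← FreeAlgebra.span_words] at ht
    refine Submodule.span_le.2 ?_ ht
    rintro _ ⟨w, rfl⟩
    obtain h | h : (w.countP Sum.isRight : ZMod 2) = 0 ∨ (w.countP Sum.isRight : ZMod 2) = 1 := by
      generalize (w.countP Sum.isRight : ZMod 2) = i
      revert i; decide
    · exact Submodule.mem_sup_left (Submodule.subset_span ⟨w, h, rfl⟩)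
    · exact Submodule.mem_sup_right (Submodule.subset_span ⟨w, h, rfl⟩)
  obtain ⟨g, hg, h, hh, e⟩ := Submodule.mem_sup.1 hf
  exact ⟨g, hg, h, hh, e.symm⟩

/-- The class of a polynomial in the free supercommutative algebra. -/
abbrev FreeSupercomm.mk : FreeAlgebra C (ℕ ⊕ ℕ) →ₐ[C] FreeSupercomm C :=
  RingQuot.mkAlgHom C (SupercommRel C)

theorem FreeSupercomm.mk_even_mul {f : FreeAlgebra C (ℕ ⊕ ℕ)} (hf : f ∈ parityPart C 0)
    (a : FreeSupercomm C) : mk C f * a = a * mk C f := by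
  obtain ⟨g, rfl⟩ := RingQuot.mkAlgHom_surjective C (SupercommRel C) a
  obtain ⟨g₀, h₀, g₁, h₁, rfl⟩ := exists_parity_add C g
  have e₀ := RingQuot.mkAlgHom_rel C (SupercommRel.swap 0 0 f g₀ hf h₀)
  have e₁ := RingQuot.mkAlgHom_rel C (SupercommRel.swap 0 1 f g₁ hf h₁)
  simp only [ZMod.val_zero, zero_mul, pow_zero, one_mul, map_mul] at e₀ e₁
  rw [map_add, mul_add, add_mul, e₀, e₁]

theorem lie_add_add_of_central {A : Type*} [Ring A] {p q : A} (hp : ∀ a, p * a = a * p)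
    (hq : ∀ a, q * a = a * q) (a b : A) : ⁅p + a, q + b⁆ = a * b - b * a := by
  rw [Ring.lie_def, add_mul, hp, mul_add a, ← hq a]
  noncomm_ring

/-- A commutator equals the commutator of the odd parts, which is even and hence central. -/
theorem FreeSupercomm.lie_lie (a b c : FreeSupercomm C) : ⁅a, ⁅b, c⁆⁆ = 0 := by
  obtain ⟨f, rfl⟩ := RingQuot.mkAlgHom_surjective C (SupercommRel C) b
  obtain ⟨g, rfl⟩ := RingQuot.mkAlgHom_surjective C (SupercommRel C) c
  obtain ⟨f₀, hf₀, f₁, hf₁, rfl⟩ := exists_parity_add C f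
  obtain ⟨g₀, hg₀, g₁, hg₁, rfl⟩ := exists_parity_add C g
  have hz : f₁ * g₁ - g₁ * f₁ ∈ parityPart C 0 := by
    rw [show (0 : ZMod 2) = 1 + 1 by decide]
    exact sub_mem (mul_mem_parityPart C hf₁ hg₁) (mul_mem_parityPart C hg₁ hf₁)
  have e : ⁅mk C (f₀ + f₁), mk C (g₀ + g₁)⁆ = mk C (f₁ * g₁ - g₁ * f₁) := by
    rw [map_add, map_add, lie_add_add_of_central (mk_even_mul C hf₀) (mk_even_mul C hg₀), map_sub,
      map_mul, map_mul]
  rw [e, Ring.lie_def, mk_even_mul C hz, sub_self]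

end Supercommutative

/-! ### T-ideals -/

section TIdeals

variable (C : Type*) [CommRing C]

theorem isTIdeal_identities (A : Type*) [Ring A] [Algebra C A] :
    IsTIdeal (identities C A) := by
  intro τ f hf
  rw [mem_identities] at hf ⊢
  intro a
  have h : (FreeAlgebra.lift C a).comp τ =
      FreeAlgebra.lift C (fun i => FreeAlgebra.lift C a (τ (FreeAlgebra.ι C i))) := by
    ext i; simp
  rw [← AlgHom.comp_apply, h]
  exact hf _

theorem isIdentity_grassmannPoly : IsIdentity C (FreeSupercomm C) (grassmannPoly C) := by
  intro a
  simpa [grassmannPoly, Ring.lie_def] using FreeSupercomm.lie_lie C (a 0) (a 1) (a 2)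

theorem tIdealSpan_le_identities :
    tIdealSpan {grassmannPoly C} ≤ identities C (FreeSupercomm C) :=
  sInf_le ⟨isTIdeal_identities C _, by
    simpa [mem_identities] using isIdentity_grassmannPoly C⟩

theorem lie_lie_mem_tIdealSpan (f g h : FreeAlgebra C ℕ) :
    ⁅f, ⁅g, h⁆⁆ ∈ tIdealSpan {grassmannPoly C} := by
  rw [tIdealSpan, TwoSidedIdeal.mem_sInf]
  rintro I ⟨hI, hs⟩
  have := hI (FreeAlgebra.lift C fun i => if i = 0 then f else if i = 1 then g else h)
    (grassmannPoly C) (hs rfl)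
  simpa [grassmannPoly, Ring.lie_def] using this

/-- Modulo the T-ideal generated by the Grassmann identity, every polynomial is a linear
combination of normal monomials. -/
theorem exists_sub_sum_normalMonomial_mem (f : FreeAlgebra C ℕ) :
    ∃ c : Multiset ℕ × {s : Finset ℕ // Even s.card} →₀ C,
      f - c.sum (fun t r => r • normalMonomial (FreeAlgebra.ι C) t.1 (t.2 : Finset ℕ)) ∈
        tIdealSpan {grassmannPoly C} := by
  set I := tIdealSpan {grassmannPoly C}
  let π : FreeAlgebra C ℕ →ₐ[C] I.ringCon.Quotient := I.ringCon.mkₐ C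
  have hπ : Function.Surjective π := I.ringCon.mk'_surjective
  have hker (g : FreeAlgebra C ℕ) : π g = 0 ↔ g ∈ I := by
    have h := TwoSidedIdeal.mem_ker (f := I.ringCon.mk') (x := g)
    rw [TwoSidedIdeal.ker_ringCon_mk'] at h
    exact h.symm
  have hA (a b c : I.ringCon.Quotient) : ⁅a, ⁅b, c⁆⁆ = 0 := by
    obtain ⟨a, rfl⟩ := hπ a
    obtain ⟨b, rfl⟩ := hπ b
    obtain ⟨c, rfl⟩ := hπ c
    have := (hker _).2 (lie_lie_mem_tIdealSpan C a b c)
    simpa [Ring.lie_def] using this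
  have hmem := lift_mem_span_normalMonomial (C := C) hA (fun i => π (FreeAlgebra.ι C i)) f
  have hlift : FreeAlgebra.lift C (fun i => π (FreeAlgebra.ι C i)) = π := by ext i; simp
  rw [hlift, Finsupp.mem_span_range_iff_exists_finsupp] at hmem
  obtain ⟨c, hc⟩ := hmem
  refine ⟨c, (hker _).1 ?_⟩
  rw [map_sub, ← hc, Finsupp.sum, Finsupp.sum, map_sum, sub_eq_zero]
  refine Finset.sum_congr rfl fun t _ => ?_
  rw [map_smul]
  exact congrArg _ (map_normalMonomial π _ _ _).symm

end TIdeals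

/-! ### Evaluation at a sum of a central and an odd element -/

section Evaluation

variable {B : Type*} [Ring B] {x y z : ℕ → B}

/-- Anticommuting elements of square zero annihilate every product in which they occur. -/
theorem mul_prod_eq_zero_of_mem (hz : ∀ i j, z i * z j = -(z j * z i)) (hsq : ∀ i, z i * z i = 0)
    {i : ℕ} : ∀ {l : List ℕ}, i ∈ l → z i * (l.map z).prod = 0
  | j :: l, h => by
    rw [List.map_cons, List.prod_cons, ← mul_assoc]
    rcases List.mem_cons.1 h with rfl | h
    · rw [hsq, zero_mul]
    · rw [hz, neg_mul, mul_assoc, mul_prod_eq_zero_of_mem hz hsq h, mul_zero, neg_zero]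

theorem commProd_add (hy : ∀ i b, y i * b = b * y i) (hz : ∀ i j, z i * z j = -(z j * z i)) :
    ∀ l : List ℕ, Even l.length →
      commProd (fun i => y i + z i) l = 2 ^ (l.length / 2) * (l.map z).prod
  | [], _ => by simp [commProd]
  | [_], h => by simp at h
  | a :: b :: l, h => by
    have hl : Even l.length := by simpa [Nat.even_add_one, parity_simps] using h
    have e : ⁅y a + z a, y b + z b⁆ = 2 * (z a * z b) := by
      rw [lie_add_add_of_central (hy a) (hy b), hz b a, sub_neg_eq_add, two_mul]
    have hc : (z a * z b) * (2 : B) ^ (l.length / 2) = 2 ^ (l.length / 2) * (z a * z b) :=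
      ((Nat.cast_commute 2 (z a * z b)).pow_left _).symm.eq
    rw [commProd, commProd_add hy hz l hl, e, mul_assoc, ← mul_assoc (z a * z b), hc]
    simp only [List.length_cons, List.map_cons, List.prod_cons, mul_assoc]
    rw [show (l.length + 1 + 1) / 2 = l.length / 2 + 1 by omega, pow_succ', mul_assoc]

/-- In front of an element killed by all odd parts, only the central parts of the factors
matter. -/
theorem prod_add_mul (hy : ∀ i b, y i * b = b * y i) {e : B} (he : ∀ i, z i * e = 0) :
    ∀ l : List ℕ, (l.map fun i => y i + z i).prod * e = (l.map y).prod * e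
  | [] => by simp
  | a :: l => by
    have hc : ∀ l : List ℕ, ∀ b, (l.map y).prod * b = b * (l.map y).prod := by
      intro l b
      refine (Commute.list_prod_left _ _ fun u hu => ?_).eq
      obtain ⟨i, _, rfl⟩ := List.mem_map.1 hu
      exact hy i b
    rw [List.map_cons, List.prod_cons, mul_assoc, prod_add_mul hy he l, add_mul, hc l e,
      ← mul_assoc (z a), he, zero_mul, add_zero, List.map_cons, List.prod_cons, mul_assoc, hc l e]

end Evaluation

/-! ### Polynomials with values in an exterior algebra -/

section ExteriorModel

variable (C : Type*) [CommRing C]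

/-- The exterior algebra of a module of infinite rank over the ring of polynomials in countably
many variables. It receives a homomorphism from the free supercommutative algebra that sends `yₙ`
to the `n`-th variable and `zₙ` to the `n`-th unit vector. -/
abbrev ExteriorModel : Type _ :=
  ExteriorAlgebra (MvPolynomial ℕ C) (ℕ → MvPolynomial ℕ C)

/-- The even generators of the exterior model: the variables of the polynomial ring. -/
noncomputable def evenGen (i : ℕ) : ExteriorModel C :=
  algebraMap _ _ (MvPolynomial.X i : MvPolynomial ℕ C)

/-- The odd generators of the exterior model: the unit vectors. -/
noncomputable def oddGen (i : ℕ) : ExteriorModel C := ExteriorAlgebra.ι _ (Pi.single i 1)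

theorem evenGen_mul (i : ℕ) (b : ExteriorModel C) : evenGen C i * b = b * evenGen C i :=
  Algebra.commutes _ _

theorem oddGen_mul_oddGen (i j : ℕ) : oddGen C i * oddGen C j = -(oddGen C j * oddGen C i) :=
  eq_neg_of_add_eq_zero_left (ExteriorAlgebra.ι_add_mul_swap _ _)

theorem oddGen_mul_self (i : ℕ) : oddGen C i * oddGen C i = 0 :=
  ExteriorAlgebra.ι_sq_zero _

/-- A product of distinct odd generators is annihilated by no nonzero polynomial: the linear form
on the exterior algebra that is given by the minors in the corresponding columns sends this product
to `1`. -/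
theorem eq_zero_of_smul_prod_oddGen {p : MvPolynomial ℕ C} {l : List ℕ} (hl : l.Nodup)
    (h : p • (l.map (oddGen C)).prod = 0) : p = 0 := by
  let D : (ℕ → MvPolynomial ℕ C) [⋀^Fin l.length]→ₗ[MvPolynomial ℕ C] MvPolynomial ℕ C :=
    Matrix.detRowAlternating.compLinearMap (LinearMap.funLeft _ _ l.get)
  let F := ExteriorAlgebra.liftAlternating (R := MvPolynomial ℕ C)
    (Function.update (fun _ => 0) l.length D)
  have hprod : (l.map (oddGen C)).prod = ExteriorAlgebra.ιMulti (MvPolynomial ℕ C) l.length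
      fun i => Pi.single (l.get i) 1 := by
    rw [ExteriorAlgebra.ιMulti_apply]
    congr 1
    refine List.ext_getElem (by simp) fun n h₁ h₂ => ?_
    simp [oddGen]
  have hF : F (l.map (oddGen C)).prod = 1 := by
    rw [hprod, ExteriorAlgebra.liftAlternating_apply_ιMulti, Function.update_self]
    have : (fun i : Fin l.length => LinearMap.funLeft (MvPolynomial ℕ C) (MvPolynomial ℕ C) l.get
        (Pi.single (l.get i) 1)) = (1 : Matrix _ _ (MvPolynomial ℕ C)) := by
      ext1 i
      ext1 j
      have hij : l.get j = l.get i ↔ i = j :=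
        (List.nodup_iff_injective_get.1 hl).eq_iff.trans eq_comm
      simp only [LinearMap.funLeft_apply, Matrix.one_apply, Pi.single_apply, hij]
    change Matrix.det (fun i : Fin l.length => LinearMap.funLeft (MvPolynomial ℕ C)
      (MvPolynomial ℕ C) l.get (Pi.single (l.get i) 1)) = 1
    rw [this, Matrix.det_one]
  have := congrArg F h
  rwa [map_smul, hF, map_zero, smul_eq_mul, mul_one] at this

theorem prod_evenGen (m : Multiset ℕ) :
    (m.sort.map (evenGen C)).prod =
      algebraMap _ _ (MvPolynomial.monomial (Multiset.toFinsupp m) (1 : C)) := by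
  have e : (m.map (MvPolynomial.X : ℕ → MvPolynomial ℕ C)).prod =
      MvPolynomial.monomial (Multiset.toFinsupp m) 1 := by
    rw [MvPolynomial.monomial_eq, map_one, one_mul, Finsupp.prod, Finset.prod_multiset_map_count]
    simp
  rw [← e]
  conv_rhs => rw [← Multiset.sort_eq m (· ≤ ·), Multiset.map_coe, Multiset.prod_coe, map_list_prod,
    List.map_map]
  rfl

/-- The images of the generators of the free superalgebra in the exterior model. -/
noncomputable def superGen : ℕ ⊕ ℕ → ExteriorModel C := Sum.elim (evenGen C) (oddGen C)

theorem superGen_mul_prod (g : ℕ ⊕ ℕ) (w : List (ℕ ⊕ ℕ)) :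
    superGen C g * (w.map (superGen C)).prod =
      (-1) ^ ([g].countP Sum.isRight * w.countP Sum.isRight) *
        ((w.map (superGen C)).prod * superGen C g) := by
  induction w with
  | nil => simp
  | cons b w ih =>
    rw [List.map_cons, List.prod_cons, ← mul_assoc]
    rcases g with i | i
    · simp only [superGen, Sum.elim_inl]
      rw [mul_assoc, evenGen_mul]
      simp
    · rcases b with j | j
      · simp only [superGen, Sum.elim_inl, Sum.elim_inr] at ih ⊢
        rw [← evenGen_mul C j (oddGen C i), mul_assoc, ih, ← mul_assoc,
          evenGen_mul C j ((-1) ^ _)]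
        simp [mul_assoc]
      · simp only [superGen, Sum.elim_inr] at ih ⊢
        rw [oddGen_mul_oddGen, neg_mul, mul_assoc, ih,
          ← mul_assoc (oddGen C j), ← (((Commute.one_left _).neg_left).pow_left _).eq]
        simp [List.countP_cons, pow_succ, mul_assoc]

theorem prod_superGen_mul_prod (v w : List (ℕ ⊕ ℕ)) :
    (v.map (superGen C)).prod * (w.map (superGen C)).prod =
      (-1) ^ (v.countP Sum.isRight * w.countP Sum.isRight) *
        ((w.map (superGen C)).prod * (v.map (superGen C)).prod) := by
  induction v with
  | nil => simp
  | cons g v ih =>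
    have hc (n : ℕ) (b : ExteriorModel C) : b * (-1) ^ n = (-1) ^ n * b :=
      (((Commute.one_left b).neg_left).pow_left n).symm.eq
    have hcount : (g :: v).countP Sum.isRight = [g].countP Sum.isRight + v.countP Sum.isRight := by
      simp [List.countP_cons, add_comm]
    rw [List.map_cons, List.prod_cons, mul_assoc, ih, ← mul_assoc, hc, mul_assoc,
      ← mul_assoc (superGen C g), superGen_mul_prod, hcount, add_mul, pow_add]
    simp only [← mul_assoc]
    rw [((Commute.refl (-1 : ExteriorModel C)).pow_pow _ _).eq]

theorem lift_superGen_rel ⦃f g : FreeAlgebra C (ℕ ⊕ ℕ)⦄ (h : SupercommRel C f g) :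
    FreeAlgebra.lift C (superGen C) f = FreeAlgebra.lift C (superGen C) g := by
  obtain ⟨i, j, f, g, hf, hg⟩ := h
  simp only [map_mul, map_pow, map_neg, map_one]
  induction hf using Submodule.span_induction with
  | mem f hf =>
    obtain ⟨v, hv, rfl⟩ := hf
    induction hg using Submodule.span_induction with
    | mem g hg =>
      obtain ⟨w, hw, rfl⟩ := hg
      have e (u : List (ℕ ⊕ ℕ)) : FreeAlgebra.lift C (superGen C) (word C u) =
          (u.map (superGen C)).prod := by
        simp [word, map_list_prod, Function.comp_def]
      rw [e, e, prod_superGen_mul_prod, ← hv, ← hw, ZMod.val_natCast, ZMod.val_natCast,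
        neg_one_pow_eq_pow_mod_two, Nat.mul_mod, ← neg_one_pow_eq_pow_mod_two]
    | zero => simp
    | add g g' _ _ h h' => rw [map_add, mul_add, add_mul, mul_add, h, h']
    | smul c g _ h => rw [map_smul, mul_smul_comm, smul_mul_assoc, mul_smul_comm, h]
  | zero => simp
  | add f f' _ _ h h' => rw [map_add, mul_add, add_mul, mul_add, h, h']
  | smul c f _ h => rw [map_smul, mul_smul_comm, smul_mul_assoc, mul_smul_comm, h]

/-- The homomorphism from the free supercommutative algebra to the exterior model. -/
noncomputable def toExteriorModel : FreeSupercomm C →ₐ[C] ExteriorModel C :=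
  RingQuot.liftAlgHom C ⟨FreeAlgebra.lift C (superGen C), lift_superGen_rel C⟩

/-- The substitution that sends `xᵢ` to `yᵢ + zᵢ` for `i` in `s` and to `yᵢ` otherwise gives the
value `0` to every identity of the free supercommutative algebra. -/
theorem lift_exteriorModel_eq_zero {f : FreeAlgebra C ℕ}
    (hf : IsIdentity C (FreeSupercomm C) f) (s : Finset ℕ) :
    FreeAlgebra.lift C (fun i => evenGen C i + if i ∈ s then oddGen C i else 0) f = 0 := by
  have h := congrArg (toExteriorModel C) (hf fun i =>
    FreeSupercomm.mk C (FreeAlgebra.ι C (Sum.inl i) +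
      if i ∈ s then FreeAlgebra.ι C (Sum.inr i) else 0))
  rw [map_zero, ← AlgHom.comp_apply] at h
  refine Eq.trans ?_ h
  congr 1
  ext i
  have e (g : FreeAlgebra C (ℕ ⊕ ℕ)) :
      toExteriorModel C (FreeSupercomm.mk C g) = FreeAlgebra.lift C (superGen C) g :=
    RingQuot.liftAlgHom_mkAlgHom_apply _ _ _ _
  simp only [Function.comp_apply, FreeAlgebra.lift_ι_apply, AlgHom.coe_comp, e, map_add]
  split_ifs <;> simp [superGen]

/-- Under the substitution attached to `s`, a normal monomial whose commutator part is indexed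
by `t` vanishes unless `t` is contained in `s`. -/
theorem normalMonomial_eq_zero {s t : Finset ℕ} (ht : Even t.card) (hts : ¬ t ⊆ s)
    (m : Multiset ℕ) :
    normalMonomial (fun i => evenGen C i + if i ∈ s then oddGen C i else 0) m t = 0 := by
  obtain ⟨i, hit, his⟩ := Finset.not_subset.1 hts
  rw [normalMonomial, commProd_add (evenGen_mul C) _ _ (by rwa [Finset.length_sort])]
  · have h0 : (t.sort.map fun i => if i ∈ s then oddGen C i else 0).prod = 0 :=
      List.prod_eq_zero (List.mem_map.2 ⟨i, by simpa using hit, if_neg his⟩)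
    rw [h0, mul_zero, mul_zero]
  · intro i j
    split_ifs <;> simp [oddGen_mul_oddGen C i j]

/-- Under the substitution attached to `s`, a normal monomial with commutator part indexed by `s`
becomes a power of `2` times its commutative monomial times the product of all `zᵢ`, `i ∈ s`:
every other contribution of a `zᵢ` repeats an odd factor. -/
theorem normalMonomial_eq_smul {s : Finset ℕ} (hs : Even s.card) (m : Multiset ℕ) :
    normalMonomial (fun i => evenGen C i + if i ∈ s then oddGen C i else 0) m s =
      (2 ^ (s.card / 2) * MvPolynomial.monomial (Multiset.toFinsupp m) (1 : C)) •
        (s.sort.map (oddGen C)).prod := by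
  have hmap : s.sort.map (fun i => if i ∈ s then oddGen C i else 0) = s.sort.map (oddGen C) :=
    List.map_congr_left fun i hi => if_pos (by simpa using hi)
  have hanti (i j : ℕ) : (if i ∈ s then oddGen C i else 0) * (if j ∈ s then oddGen C j else 0) =
      -((if j ∈ s then oddGen C j else 0) * (if i ∈ s then oddGen C i else 0)) := by
    split_ifs <;> simp [oddGen_mul_oddGen C i j]
  rw [normalMonomial, commProd_add (evenGen_mul C) hanti _ (by rwa [Finset.length_sort]),
    prod_add_mul (evenGen_mul C), hmap, prod_evenGen, Finset.length_sort, Algebra.smul_def, map_mul,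
    map_pow, map_ofNat, ← mul_assoc]
  · rw [((Nat.cast_commute 2 _).pow_left _).eq]
  · intro i
    rw [← mul_assoc, ← ((Nat.cast_commute 2 _).pow_left _).eq, mul_assoc, hmap]
    split_ifs with hi
    · rw [mul_prod_eq_zero_of_mem (oddGen_mul_oddGen C) (oddGen_mul_self C) (by simpa using hi),
        mul_zero]
    · rw [zero_mul, mul_zero]

/-- Normal monomials are linearly independent modulo the identities of the free supercommutative
algebra. -/
theorem eq_zero_of_sum_normalMonomial_isIdentity (h2 : IsUnit (2 : C))
    (c : Multiset ℕ × {s : Finset ℕ // Even s.card} →₀ C)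
    (hc : IsIdentity C (FreeSupercomm C)
      (c.sum fun t r => r • normalMonomial (FreeAlgebra.ι C) t.1 (t.2 : Finset ℕ))) :
    c = 0 := by
  by_contra hne
  -- Choose a monomial with nonzero coefficient whose commutator part is shortest.
  obtain ⟨⟨m, s⟩, hms, hmin⟩ := Finset.exists_min_image c.support
    (fun t => (t.2 : Finset ℕ).card) (Finsupp.support_nonempty_iff.2 hne)
  have h := lift_exteriorModel_eq_zero C hc s
  rw [Finsupp.sum, map_sum] at h
  have hterm : ∀ t ∈ c.support, FreeAlgebra.lift C
      (fun i => evenGen C i + if i ∈ (s : Finset ℕ) then oddGen C i else 0)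
        (c t • normalMonomial (FreeAlgebra.ι C) t.1 (t.2 : Finset ℕ)) =
      (2 ^ ((s : Finset ℕ).card / 2) * if t.2 = s then
        MvPolynomial.monomial (Multiset.toFinsupp t.1) (c t) else 0) •
        ((s : Finset ℕ).sort.map (oddGen C)).prod := by
    intro t ht
    have e : FreeAlgebra.lift C
        (fun i => evenGen C i + if i ∈ (s : Finset ℕ) then oddGen C i else 0)
          (normalMonomial (FreeAlgebra.ι C) t.1 (t.2 : Finset ℕ)) =
        normalMonomial (fun i => evenGen C i + if i ∈ (s : Finset ℕ) then oddGen C i else 0)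
          t.1 (t.2 : Finset ℕ) := by
      refine (map_normalMonomial (FreeAlgebra.lift C _) _ _ _).trans ?_
      congr 1
      ext1 i
      simp
    rw [map_smul, e]
    split_ifs with hts
    · rw [hts, normalMonomial_eq_smul C s.2, ← smul_assoc, ← mul_smul_comm,
        MvPolynomial.smul_monomial, smul_eq_mul, mul_one]
    · rw [normalMonomial_eq_zero C t.2.2, smul_zero, mul_zero, zero_smul]
      exact fun hsub => hts (Subtype.ext (Finset.eq_of_subset_of_card_le hsub (hmin t ht)))
  rw [Finset.sum_congr rfl hterm, ← Finset.sum_smul, ← Finset.mul_sum] at h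
  have hp := eq_zero_of_smul_prod_oddGen C (Finset.sort_nodup _ _) h
  have h2' : IsUnit ((2 : MvPolynomial ℕ C) ^ ((s : Finset ℕ).card / 2)) := by
    have := h2.map (MvPolynomial.C (σ := ℕ))
    rw [map_ofNat] at this
    exact this.pow _
  rw [h2'.mul_right_eq_zero] at hp
  -- The coefficient of the commutative monomial attached to `m` is the one of the chosen term.
  have hcoeff := congrArg (MvPolynomial.coeff (Multiset.toFinsupp m)) hp
  rw [MvPolynomial.coeff_sum, Finset.sum_eq_single (m, s), if_pos rfl, MvPolynomial.coeff_monomial,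
    if_pos rfl, MvPolynomial.coeff_zero] at hcoeff
  · exact Finsupp.mem_support_iff.1 hms hcoeff
  · rintro ⟨m', s'⟩ _ hne'
    split_ifs with hs'
    · rw [MvPolynomial.coeff_monomial, if_neg]
      intro hm
      exact hne' (Prod.ext (Multiset.toFinsupp.injective hm) hs')
    · exact MvPolynomial.coeff_zero _
  · exact fun hn => absurd hms hn

end ExteriorModel

end GrassmannPI

theorem mainTheorem3 (C : Type*) [CommRing C] (h2 : IsUnit (2 : C)) :
    GrassmannPI.identities C (GrassmannPI.FreeSupercomm C) =
      GrassmannPI.tIdealSpan {GrassmannPI.grassmannPoly C} := by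
  refine le_antisymm (fun f hf => ?_) (GrassmannPI.tIdealSpan_le_identities C)
  obtain ⟨c, hc⟩ := GrassmannPI.exists_sub_sum_normalMonomial_mem C f
  have hsum := sub_mem hf (GrassmannPI.tIdealSpan_le_identities C hc)
  rw [sub_sub_cancel, GrassmannPI.mem_identities] at hsum
  rw [GrassmannPI.eq_zero_of_sum_normalMonomial_isIdentity C h2 c hsum, Finsupp.sum_zero_index,
    sub_zero] at hc
  exact hc
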